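/- All logarithms are binary. Fix the standard enumeration $T_0,T_1,\dots$ of the partial recursive functions and the reference universal machine $U$ that, on the binary program $1^i0p$ and side information $y$, returns $T_i(\langle p,y\rangle)$. Let $C(x\mid y)$ be the length of a shortest binary program from which $U$, given $y$, computes $x$. A labeled graph $G$ on the nodes $\{1,\dots,n\}$ is identified with the string $E(G)\in\{0,1\}^{n(n-1)/2}$ that lists, in lexicographical order of the pairs $u<v$, which edges are present. For a real $\delta(n)\ge 0$, $G$ is called $\delta(n)$-random if $C(E(G)\mid n,\lfloor\delta(n)\rfloor)\ge n(n-1)/2-\delta(n)$. A routing scheme for $G$ gives every node $u$ a local routing function, which maps each destination $w\ne u$ to a neighbour of $u$, the next node on the route to $w$. It has stretch factor at most $s$ if, for all $u\neq w$, following the local routing functions from $u$ leads to $w$ in at most $s\cdot d_G(u,w)$ steps. Nodes keep their labels and know their own label and the labels of their neighbours for free: a binary string $p$ stores the local routing function of $u$ if, for every destination $w\ne u$, $U$ on program $p$ computes the label of the next node from the label of $u$, the increasing list of the labels of the neighbours of $u$, and the label of $w$. The number of bits used at $u$ is the length of $p$. **Theorem.** Let $c\ge 0$ be a constant. There are constants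 $C$ and $N$, depending only on $c$, such that every $c\log n$-random labeled graph $G$ on $n\ge N$ nodes has a routing scheme of stretch factor at most $2$ whose local routing functions are stored in at most $\log\log n+C$ bits at each of $n-1$ nodes and in at most $3n$ bits at the one remaining node, and the complete routing scheme is stored in at most $n\log\log n+3n$ bits in total. -/

import Mathlib

namespace CompactRouting

/-! ### Kolmogorov complexity -/

/-- The reference universal machine. The program `1^i 0 p` (a binary string) with side
information `y` runs the `i`-th partial recursive function in the standard enumeration
on the pair `⟨p, y⟩`. A string without the separator `0` computes nothing. -/
def universal : List Bool → ℕ → Part ℕ :=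
  fun prog y =>
    match prog.dropWhile (fun b => b) with
    | [] => Part.none
    | _ :: p =>
      (Denumerable.ofNat Nat.Partrec.Code (prog.takeWhile (fun b => b)).length).eval
        (Encodable.encode (p, y))

/-- `prog` is a program that computes `x` from `y` on the reference machine. -/
def Computes {α β : Type} [Primcodable α] [Primcodable β]
    (prog : List Bool) (y : β) (x : α) : Prop :=
  Encodable.encode x ∈ universal prog (Encodable.encode y)

/-- Every object is computed by some program, so that the minimum below is attained. -/
theorem exists_computes {α β : Type} [Primcodable α] [Primcodable β] (x : α) (y : β) :
    ∃ prog : List Bool, Computes prog y x := by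
  refine ⟨List.replicate
    (Encodable.encode (Nat.Partrec.Code.const (Encodable.encode x))) true ++ [false], ?_⟩
  simp [Computes, universal]

/-- The Kolmogorov complexity `C(x | y)`: the length of a shortest program that
computes `x` from `y`. -/
noncomputable def complexity {α β : Type} [Primcodable α] [Primcodable β] (x : α) (y : β) : ℕ :=
  sInf {k | ∃ prog : List Bool, prog.length = k ∧ Computes prog y x}

/-! ### Labeled graphs and random graphs -/

/-- The possible edges `(u, v)` with `u < v`, in lexicographical order. -/
def edgeSlots (n : ℕ) : List (Fin n × Fin n) :=
  (List.product (List.finRange n) (List.finRange n)).filter (fun e => e.1 < e.2)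

open Classical in
/-- The binary string `E(G)`: the `i`-th bit says whether the `i`-th possible edge
is present. -/
noncomputable def graphCode {n : ℕ} (G : SimpleGraph (Fin n)) : List Bool :=
  (edgeSlots n).map (fun e => decide (G.Adj e.1 e.2))

/-- `G` is `δ(n)`-random among all labeled graphs on `n` nodes:
`C(E(G) | n, δ(n)) ≥ n(n-1)/2 - δ(n)`. The deficiency is rounded down to a natural
number when it is given to the machine as side information. -/
def IsRandomGraph (δ : ℕ → ℝ) {n : ℕ} (G : SimpleGraph (Fin n)) : Prop :=
  (n : ℝ) * ((n : ℝ) - 1) / 2 - δ n ≤ (complexity (graphCode G) (n, ⌊δ n⌋₊) : ℝ)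

/-! ### Routing -/

/-- The label of a node; the labels are `1, …, n`. -/
def label {n : ℕ} (v : Fin n) : ℕ := (v : ℕ) + 1

open Classical in
/-- The labels of the neighbours of `v`, in increasing order. -/
noncomputable def neighbourLabels {n : ℕ} (G : SimpleGraph (Fin n)) (v : Fin n) : List ℕ :=
  ((List.finRange n).filter (fun w => decide (G.Adj v w))).map label

/-- A routing scheme gives each node `u` its local routing function `F u`, which sends a
destination `w ≠ u` to the neighbour of `u` across the edge over which a message for `w`
leaves `u`. -/
structure RoutingScheme {n : ℕ} (G : SimpleGraph (Fin n)) where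
  next : Fin n → Fin n → Fin n
  adj_next : ∀ u w, u ≠ w → G.Adj u (next u w)

/-- `F.Route w u k`: a message for `w` that is at `u` reaches `w` after exactly `k` hops. -/
inductive RoutingScheme.Route {n : ℕ} {G : SimpleGraph (Fin n)} (F : RoutingScheme G)
    (w : Fin n) : Fin n → ℕ → Prop
  | arrived : RoutingScheme.Route F w w 0
  | hop {u : Fin n} {k : ℕ} (h : u ≠ w) (hr : RoutingScheme.Route F w (F.next u w) k) :
      RoutingScheme.Route F w u (k + 1)

/-- The scheme delivers every message, over a route at most `s` times as long as a shortest
path. (If `w` could not be reached from `u ≠ w`, then `G.dist u w = 0` and the inequality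
would fail.) -/
def RoutingScheme.StretchAtMost {n : ℕ} {G : SimpleGraph (Fin n)} (F : RoutingScheme G)
    (s : ℝ) : Prop :=
  ∀ u w, u ≠ w → ∃ k : ℕ, F.Route w u k ∧ (k : ℝ) ≤ s * (G.dist u w : ℝ)

/-- The binary string `prog` stores the local routing function of `v` when nodes know their
neighbours: from the label of `v` and the labels of its neighbours, which are free, and the
label of a destination `w ≠ v`, the reference machine run on `prog` computes the label of the
neighbour to which a message for `w` is sent. -/
def RoutingScheme.StoredBy {n : ℕ} {G : SimpleGraph (Fin n)} (F : RoutingScheme G)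
    (v : Fin n) (prog : List Bool) : Prop :=
  ∀ w, w ≠ v → Computes prog (label v, neighbourLabels G v, label w) (label (F.next v w))

end CompactRouting

/-!
Node `0` serves as a hub. The graphs on `n` nodes with a decidable property can be listed, so the
index in this list describes such a graph. Hence, if a random graph has the property with
probability `q n` and `n ^ c * q n → 0`, then no `c log n`-random graph has it, for large `n`.

This shows that in a `c log n`-random graph more than a quarter of the nodes are neighbours of the
hub; that every other node has a common neighbour with it among the first `O(log n)` nodes, whose
index takes `log log n + O(1)` bits; and that `3n - O(1)` bits suffice to list in unary, for every
node, which neighbour of the hub leads to it. The last bound comes from an exponential moment: an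
entry of the list counts the failures before the first success in a sequence of fair coin flips.

A message whose destination is not in sight is sent up to the hub in at most two hops, and from
there down to its destination in at most two more; the destination was at distance at least two.
-/

namespace CompactRouting

open Encodable Filter Finset Topology
open scoped BigOperators

section Primrec

variable {α β : Type} [Primcodable α] [Primcodable β]

theorem primrec_list_sum_map {f : α → List β} {g : α → β → ℕ}
    (hf : Primrec f) (hg : Primrec₂ g) : Primrec fun a => ((f a).map (g a)).sum :=
  Primrec.list_foldr (Primrec.list_map hf hg) (Primrec.const 0)
    (Primrec.nat_add.comp (Primrec.fst.comp Primrec.snd) (Primrec.snd.comp Primrec.snd)).to₂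

theorem primrec_list_filter {f : α → List β} {p : α → β → Prop} [DecidableRel p]
    (hf : Primrec f) (hp : PrimrecRel p) : Primrec fun a => (f a).filter (p a ·) :=
  (PrimrecRel.listFilter (R := fun b a => p a b) (hp.comp₂ Primrec₂.right Primrec₂.left)).comp hf
    Primrec.id

theorem primrec_list_idxOf [BEq α] [LawfulBEq α] : Primrec₂ (List.idxOf : α → List α → ℕ) := by
  classical
  refine (Primrec.list_findIdx Primrec.snd (p := fun z b => decide (b = z.1))
    (Primrec.eq.comp Primrec.snd (Primrec.fst.comp Primrec.fst)).decide.to₂).of_eq fun z => ?_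
  simp only [List.idxOf, beq_eq_decide]

theorem primrec_nat_log {b : ℕ} (hb : 1 < b) : Primrec (Nat.log b) := by
  have hpow : PrimrecRel fun n k : ℕ => b ^ k ≤ n :=
    Primrec.nat_le.comp₂ ((Primrec₂.unpaired'.1 Nat.Primrec.pow).comp₂ (Primrec₂.const b)
      Primrec₂.right) Primrec₂.left
  refine (Primrec.nat_findGreatest Primrec.id hpow).of_eq fun n => ?_
  rw [id, Nat.findGreatest_eq_iff]
  refine ⟨Nat.log_le_self b n, fun hlog => ?_, fun k hk _ => ?_⟩
  · exact Nat.pow_log_le_self b fun hn => hlog (by rw [hn, Nat.log_zero_right])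
  · exact not_le.2 (Nat.lt_pow_of_log_lt hb hk)

end Primrec

/-- All binary strings of length `k`. -/
def bitStrings : ℕ → List (List Bool)
  | 0 => [[]]
  | k + 1 => (bitStrings k).flatMap fun l => [true :: l, false :: l]

theorem mem_bitStrings {k : ℕ} {l : List Bool} : l ∈ bitStrings k ↔ l.length = k := by
  induction k generalizing l with
  | zero => simp [bitStrings]
  | succ k ih =>
    rcases l with _ | ⟨b, l⟩
    · simp [bitStrings]
    · cases b <;> simp [bitStrings, ih]

theorem length_bitStrings (k : ℕ) : (bitStrings k).length = 2 ^ k := by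
  induction k with
  | zero => rfl
  | succ k ih => simp [bitStrings, List.length_flatMap, ih, pow_succ]

theorem nodup_bitStrings (k : ℕ) : (bitStrings k).Nodup := by
  induction k with
  | zero => simp [bitStrings]
  | succ k ih =>
    rw [bitStrings, List.nodup_flatMap]
    refine ⟨fun l _ => by simp, ih.imp fun {a b} hab => ?_⟩
    simp [Function.onFun, Ne.symm hab]

theorem primrec_bitStrings : Primrec bitStrings := by
  have h : Primrec fun z : ℕ × List (List Bool) =>
      z.2.flatMap fun l => [true :: l, false :: l] :=
    Primrec.list_flatMap Primrec.snd
      (Primrec.list_cons.comp (Primrec.list_cons.comp (Primrec.const true) Primrec.snd)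
        (Primrec.list_cons.comp (Primrec.list_cons.comp (Primrec.const false) Primrec.snd)
          (Primrec.const []))).to₂
  refine (Primrec.nat_rec₁ [[]] h.to₂).of_eq fun k => ?_
  induction k with
  | zero => rfl
  | succ k ih => simp only [bitStrings, ← ih]

theorem length_filter_bitStrings (k : ℕ) (p : List Bool → Prop) [DecidablePred p] :
    ((bitStrings k).filter (p ·)).length = #{y : Fin k → Bool | p (List.ofFn y)} := by
  rw [← List.toFinset_card_of_nodup ((nodup_bitStrings k).filter _),
    ← card_map ⟨List.ofFn, List.ofFn_injective⟩]
  congr 1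
  ext x
  simp only [List.mem_toFinset, List.mem_filter, mem_bitStrings, decide_eq_true_eq, Finset.mem_map,
    mem_filter, mem_univ, true_and, Function.Embedding.coeFn_mk]
  constructor
  · rintro ⟨rfl, hx⟩
    exact ⟨x.get, by rwa [List.ofFn_get], List.ofFn_get x⟩
  · rintro ⟨y, hy, rfl⟩
    exact ⟨List.length_ofFn, hy⟩

/-- The position of a binary string among all strings of its length: a string of length `k`
serves as a name for a number below `2 ^ k`. -/
def bitIndex (p : List Bool) : ℕ := (bitStrings p.length).idxOf p

theorem primrec_bitIndex : Primrec bitIndex :=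
  primrec_list_idxOf.comp Primrec.id (primrec_bitStrings.comp Primrec.list_length)

theorem exists_bitIndex_eq {k j : ℕ} (h : j < 2 ^ k) :
    ∃ p : List Bool, p.length = k ∧ bitIndex p = j := by
  rw [← length_bitStrings] at h
  have hlength : ((bitStrings k)[j]).length = k := mem_bitStrings.1 (List.getElem_mem h)
  refine ⟨(bitStrings k)[j], hlength, ?_⟩
  rw [bitIndex, hlength]
  exact (nodup_bitStrings k).idxOf_getElem j h

/-- The program `1^i 0 p`, on which the universal machine runs machine `i` on input `p`. -/
def program (i : ℕ) (p : List Bool) : List Bool := List.replicate i true ++ false :: p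

@[simp] theorem length_program (i : ℕ) (p : List Bool) :
    (program i p).length = i + 1 + p.length := by
  simp [program, Nat.add_right_comm, ← Nat.add_assoc]

section Complexity

variable {α β : Type} [Primcodable α] [Primcodable β]

theorem exists_program_computes {f : List Bool × β →. α} (hf : Partrec f) :
    ∃ i, ∀ p y x, x ∈ f (p, y) → Computes (program i p) y x := by
  obtain ⟨code, hcode⟩ := Nat.Partrec.Code.exists_code.1 hf
  refine ⟨encode code, fun p y x hx => ?_⟩
  have hdrop : (program (encode code) p).dropWhile (fun b => b) = false :: p := by
    simp [program]
  have htake : ((program (encode code) p).takeWhile (fun b => b)).length = encode code := by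
    simp [program]
  simp only [Computes, universal, hdrop, htake, Denumerable.ofNat_encode, hcode]
  simpa [encode_prod_val] using hx

theorem complexity_le_length {x : α} {y : β} {p : List Bool} (h : Computes p y x) :
    complexity x y ≤ p.length :=
  Nat.sInf_le ⟨p, rfl, h⟩

theorem exists_complexity_le_add_clog {A : β → List α} (hA : Computable A) :
    ∃ i, ∀ y, ∀ x ∈ A y, complexity x y ≤ i + Nat.clog 2 (A y).length := by
  have hlookup : Partrec fun z : List Bool × β => ((A z.2)[bitIndex z.1]? : Part α) :=
    (Computable.list_getElem?.comp (hA.comp Computable.snd)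
      (primrec_bitIndex.to_comp.comp Computable.fst)).ofOption
  obtain ⟨i, hi⟩ := exists_program_computes hlookup
  refine ⟨i + 1, fun y x hx => ?_⟩
  obtain ⟨j, hj, rfl⟩ := List.getElem_of_mem hx
  obtain ⟨p, hp, rfl⟩ := exists_bitIndex_eq (hj.trans_le (Nat.le_pow_clog one_lt_two _))
  simpa [hp] using complexity_le_length (hi p y (A y)[bitIndex p] (by simp [hj]))

end Complexity

section Average

variable {ι K : Type*} [Fintype ι] [DecidableEq ι] [Semifield K] [CharZero K]

section Pi

variable {α : ι → Type*} [∀ i, Fintype (α i)] [∀ i, Nonempty (α i)]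

theorem expect_eq_expect_expect_piecewise (s : Set ι) [DecidablePred (· ∈ s)]
    (F : (∀ i, α i) → K) : 𝔼 ω, F ω = 𝔼 ω', 𝔼 ω, F (s.piecewise ω' ω) := by
  let swap : (∀ i, α i) × (∀ i, α i) → (∀ i, α i) × (∀ i, α i) :=
    fun z => (s.piecewise z.1 z.2, s.piecewise z.2 z.1)
  have hswap : Function.Involutive swap := fun z => by
    ext i <;> by_cases h : i ∈ s <;> simp [swap, h]
  calc 𝔼 ω, F ω = 𝔼 z : (∀ i, α i) × (∀ i, α i), F z.1 := by
        rw [← univ_product_univ, expect_product' univ univ fun ω _ => F ω]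
        simp only [Fintype.expect_const]
    _ = 𝔼 z, F (swap z).1 := (Fintype.expect_equiv hswap.toPerm _ _ fun _ => rfl).symm
    _ = _ := by
        rw [← univ_product_univ, expect_product' univ univ fun ω' ω => F (s.piecewise ω' ω)]

theorem expect_mul_of_dependsOn {s t : Set ι} (hst : Disjoint s t) {f g : (∀ i, α i) → K}
    (hf : DependsOn f s) (hg : DependsOn g t) :
    𝔼 ω, f ω * g ω = (𝔼 ω, f ω) * 𝔼 ω, g ω := by
  classical
  rw [expect_eq_expect_expect_piecewise s, Fintype.expect_mul_expect]
  refine expect_congr rfl fun ω' _ => expect_congr rfl fun ω _ => ?_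
  congr 1
  · exact hf fun i hi => by simp [hi]
  · exact hg fun i hi => by simp [Set.disjoint_right.1 hst hi]

theorem expect_prod_of_dependsOn {κ : Type*} (T : Finset κ) {s : κ → Set ι}
    (hs : (T : Set κ).PairwiseDisjoint s) {g : κ → (∀ i, α i) → K}
    (hg : ∀ k ∈ T, DependsOn (g k) (s k)) :
    𝔼 ω, ∏ k ∈ T, g k ω = ∏ k ∈ T, 𝔼 ω, g k ω := by
  classical
  induction T using Finset.induction_on with
  | empty => simp
  | insert a T ha ih =>
    have hgT : ∀ k ∈ T, DependsOn (g k) (s k) := fun k hk => hg k (mem_insert_of_mem hk)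
    have hdisjoint : Disjoint (s a) (⋃ k ∈ T, s k) := Set.disjoint_iUnion₂_right.2 fun k hk =>
      hs (by simp) (by simp [hk]) (by rintro rfl; exact ha hk)
    have hprod : DependsOn (fun ω => ∏ k ∈ T, g k ω) (⋃ k ∈ T, s k) := fun x y hxy =>
      prod_congr rfl fun k hk => hgT k hk fun i hi => hxy i (Set.mem_biUnion hk hi)
    simp only [prod_insert ha]
    rw [expect_mul_of_dependsOn hdisjoint (hg a (mem_insert_self _ _)) hprod,
      ih (hs.subset (by simp)) hgT]

end Pi

section Function

variable {κ α : Type*} [Fintype κ] [DecidableEq κ] [Fintype α] [Nonempty α]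

theorem expect_comp_injective {e : κ → ι} (he : e.Injective) (F : (κ → α) → K) :
    𝔼 ω : ι → α, F (ω ∘ e) = 𝔼 y, F y := by
  classical
  let split : (ι → α) ≃ (κ → α) × ({i // i ∉ Set.range e} → α) :=
    (Equiv.piEquivPiSubtypeProd (· ∈ Set.range e) fun _ => α).trans
      (((Equiv.ofInjective e he).arrowCongr (Equiv.refl α)).symm.prodCongr (Equiv.refl _))
  calc 𝔼 ω : ι → α, F (ω ∘ e) = 𝔼 z, F (Prod.fst z) := Fintype.expect_equiv split _ _ fun _ => rfl
    _ = 𝔼 y, F y := by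
      rw [← univ_product_univ, expect_product' univ univ fun y _ => F y]
      simp only [Fintype.expect_const]

theorem expect_apply (i : ι) (f : α → K) : 𝔼 ω : ι → α, f (ω i) = 𝔼 a, f a := by
  rw [← Fintype.expect_equiv (Equiv.funUnique Unit α) (fun y => f (y ())) f fun _ => rfl]
  exact expect_comp_injective (e := fun _ : Unit => i) (Function.injective_of_subsingleton _)
    fun y => f (y ())

end Function

theorem expect_apply_bool (i : ι) (f : Bool → K) :
    𝔼 ω : ι → Bool, f (ω i) = (f true + f false) / 2 := by
  rw [expect_apply i f, Fintype.expect_eq_sum_div_card, Fintype.sum_bool, Fintype.card_bool,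
    Nat.cast_ofNat]

end Average

section FirstSuccess

variable {ι : Type*}

theorem list_findIdx_congr {p q : ι → Bool} {l : List ι} (h : ∀ a ∈ l, p a = q a) :
    l.findIdx p = l.findIdx q := by
  induction l with
  | nil => rfl
  | cons a l ih =>
    rw [List.findIdx_cons, List.findIdx_cons, h a (by simp), ih fun b hb => h b (by simp [hb])]

theorem dependsOn_findIdx (l : List ι) :
    DependsOn (fun ω : ι → Bool => l.findIdx ω) {i | i ∈ l} :=
  fun _ _ h => list_findIdx_congr h

theorem dependsOn_apply {α β : Type*} (i : ι) (f : α → β) :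
    DependsOn (fun ω : ι → α => f (ω i)) {i} :=
  fun _ _ h => congrArg f (h i rfl)

theorem expect_pow_findIdx_le [Fintype ι] [DecidableEq ι] {r : ℝ} (hr : 1 ≤ r) (hr2 : r < 2)
    {l : List ι} (hl : l.Nodup) :
    𝔼 ω : ι → Bool, r ^ (l.findIdx ω + 1) ≤ r / (2 - r) := by
  have h2r : 0 < 2 - r := sub_pos.2 hr2
  induction l with
  | nil =>
    simp only [List.findIdx_nil, zero_add, pow_one, Fintype.expect_const]
    exact le_div_self (by linarith) h2r (by linarith)
  | cons i l ih =>
    obtain ⟨hil, hl⟩ := List.nodup_cons.1 hl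
    have hcons : ∀ ω : ι → Bool, r ^ ((i :: l).findIdx ω + 1)
        = (if ω i then r else 0) + (if ω i then 0 else r) * r ^ (l.findIdx ω + 1) := by
      intro ω
      rw [List.findIdx_cons]
      cases ω i <;> simp [pow_succ']
    have hindep := expect_mul_of_dependsOn (s := {i}) (t := {j | j ∈ l}) (by simpa using hil)
      (dependsOn_apply i fun b => if b then 0 else r)
      (fun x y h => by simp only [dependsOn_findIdx l h] :
        DependsOn (fun ω => r ^ (l.findIdx ω + 1)) {j | j ∈ l})
    calc 𝔼 ω : ι → Bool, r ^ ((i :: l).findIdx ω + 1)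
        = r / 2 + r / 2 * 𝔼 ω : ι → Bool, r ^ (l.findIdx ω + 1) := by
          simp only [hcons]
          rw [expect_add_distrib, hindep, expect_apply_bool i fun b => if b then r else 0,
            expect_apply_bool i fun b => if b then 0 else r]
          simp
      _ ≤ r / 2 + r / 2 * (r / (2 - r)) := by gcongr; exact ih hl
      _ = r / (2 - r) := by field_simp; ring

end FirstSuccess

section RandomGraph

variable {V : Type*}

/-- The graph whose edges are the pairs that carry the bit `true`. Independent fair bits give a
uniformly random graph; the bits of the loops are ignored. -/
def graphOfBits (ω : Sym2 V → Bool) : SimpleGraph V :=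
  SimpleGraph.fromEdgeSet {e | ω e = true}

theorem graphOfBits_adj {ω : Sym2 V → Bool} {u v : V} :
    (graphOfBits ω).Adj u v ↔ ω s(u, v) = true ∧ u ≠ v :=
  SimpleGraph.fromEdgeSet_adj _

variable [Fintype V] [DecidableEq V]

open Classical in
/-- The fraction of the graphs on `V` that have the property `P`. -/
noncomputable def randomGraphProb (P : SimpleGraph V → Prop) : ℝ :=
  𝔼 ω : Sym2 V → Bool, if P (graphOfBits ω) then 1 else 0

theorem randomGraphProb_nonneg (P : SimpleGraph V → Prop) : 0 ≤ randomGraphProb P :=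
  expect_nonneg fun ω _ => by split_ifs <;> norm_num

theorem randomGraphProb_le_expect_div {P : SimpleGraph V → Prop} {W : SimpleGraph V → ℝ} {a : ℝ}
    (ha : 0 < a) (hW : ∀ G, 0 ≤ W G) (h : ∀ G, P G → a ≤ W G) :
    randomGraphProb P ≤ (𝔼 ω, W (graphOfBits ω)) / a := by
  rw [randomGraphProb, expect_div]
  refine expect_le_expect fun ω _ => ?_
  split_ifs with hP
  · exact (one_le_div ha).2 (h _ hP)
  · exact div_nonneg (hW _) ha.le

theorem randomGraphProb_exists_le {ι : Type*} [Fintype ι] (P : ι → SimpleGraph V → Prop) :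
    randomGraphProb (fun G => ∃ i, P i G) ≤ ∑ i, randomGraphProb (P i) := by
  classical
  simp only [randomGraphProb]
  rw [← expect_sum_comm]
  refine expect_le_expect fun ω _ => ?_
  have hnonneg : ∀ i ∈ univ, (0 : ℝ) ≤ if P i (graphOfBits ω) then 1 else 0 :=
    fun i _ => by split_ifs <;> norm_num
  split_ifs with h
  · obtain ⟨i, hi⟩ := h
    exact (if_pos hi).ge.trans (single_le_sum hnonneg (mem_univ i))
  · exact sum_nonneg hnonneg

end RandomGraph

section GraphCode

theorem mem_edgeSlots {n : ℕ} {e : Fin n × Fin n} : e ∈ edgeSlots n ↔ e.1 < e.2 := by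
  simp only [edgeSlots, List.mem_filter, decide_eq_true_eq, and_iff_right_iff_imp]
  exact fun _ => List.pair_mem_product.2 ⟨List.mem_finRange _, List.mem_finRange _⟩

theorem nodup_edgeSlots (n : ℕ) : (edgeSlots n).Nodup :=
  ((List.nodup_finRange n).product (List.nodup_finRange n)).filter _

/-- The pair of nodes to which the `i`-th bit of the code of a graph belongs. -/
def codedPair {n : ℕ} (i : Fin (edgeSlots n).length) : Sym2 (Fin n) :=
  s((edgeSlots n)[i].1, (edgeSlots n)[i].2)

theorem codedPair_fst_lt_snd {n : ℕ} (i : Fin (edgeSlots n).length) :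
    (edgeSlots n)[i].1 < (edgeSlots n)[i].2 :=
  mem_edgeSlots.1 (List.getElem_mem i.2)

theorem codedPair_injective {n : ℕ} : Function.Injective (codedPair (n := n)) := by
  intro i j hij
  refine Fin.ext ((nodup_edgeSlots n).getElem_inj_iff (hi := i.2) (hj := j.2) |>.1 ?_)
  rcases Sym2.eq_iff.1 hij with ⟨h₁, h₂⟩ | ⟨h₁, h₂⟩
  · exact Prod.ext h₁ h₂
  · exact absurd (codedPair_fst_lt_snd i) (by rw [h₁, h₂]; exact (codedPair_fst_lt_snd j).asymm)

theorem length_edgeSlots_le (n : ℕ) : (edgeSlots n).length ≤ n.choose 2 := by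
  have h := Fintype.card_le_of_injective
    (fun i => (⟨codedPair i, (codedPair_fst_lt_snd i).ne⟩ : {e : Sym2 (Fin n) // ¬ e.IsDiag}))
    fun i j hij => codedPair_injective (congrArg Subtype.val hij)
  simpa only [Fintype.card_fin, Sym2.card_subtype_not_diag] using h

theorem graphCode_graphOfBits {n : ℕ} (ω : Sym2 (Fin n) → Bool) :
    graphCode (graphOfBits ω) = List.ofFn (ω ∘ codedPair) := by
  refine List.ext_getElem (by simp [graphCode]) fun i hi _ => ?_
  have hi' : i < (edgeSlots n).length := by simpa [graphCode] using hi
  have hne : (edgeSlots n)[i].1 ≠ (edgeSlots n)[i].2 := (codedPair_fst_lt_snd ⟨i, hi'⟩).ne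
  simp [graphCode, graphOfBits_adj, codedPair, hne]

theorem length_filter_bitStrings_eq_mul_randomGraphProb (n : ℕ) (T : List Bool → Prop)
    [DecidablePred T] :
    (((bitStrings (edgeSlots n).length).filter (T ·)).length : ℝ)
      = 2 ^ (edgeSlots n).length *
        randomGraphProb fun G : SimpleGraph (Fin n) => T (graphCode G) := by
  simp only [randomGraphProb, graphCode_graphOfBits]
  rw [expect_comp_injective codedPair_injective fun y => if T (List.ofFn y) then (1 : ℝ) else 0,
    Fintype.expect_eq_sum_div_card, sum_boole, length_filter_bitStrings]
  simp [mul_div_cancel₀]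

/-- The pairs `(u, v)` with `u < v < n`, in lexicographical order. -/
def edgePairs (n : ℕ) : List (ℕ × ℕ) :=
  (List.product (List.range n) (List.range n)).filter fun e => e.1 < e.2

theorem map_edgeSlots (n : ℕ) :
    (edgeSlots n).map (Prod.map Fin.val Fin.val) = edgePairs n := by
  have hproduct : List.product (List.range n) (List.range n)
      = (List.product (List.finRange n) (List.finRange n)).map (Prod.map Fin.val Fin.val) := by
    simp only [List.product, ← List.map_coe_finRange_eq_range, List.map_flatMap, List.flatMap_map,
      List.map_map]
    rfl
  rw [edgePairs, hproduct, List.filter_map]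
  rfl

theorem length_edgePairs (n : ℕ) : (edgePairs n).length = (edgeSlots n).length := by
  rw [← map_edgeSlots, List.length_map]

theorem primrec_edgePairs : Primrec edgePairs :=
  primrec_list_filter (p := fun (_ : ℕ) (e : ℕ × ℕ) => e.1 < e.2)
    (f := fun n => (List.range n).flatMap fun u => (List.range n).map (Prod.mk u))
    (Primrec.list_flatMap Primrec.list_range
      (Primrec.list_map (Primrec.list_range.comp Primrec.fst)
        (Primrec.pair (Primrec.snd.comp Primrec.fst) Primrec.snd).to₂).to₂)
    (Primrec.nat_lt.comp (Primrec.fst.comp Primrec.snd) (Primrec.snd.comp Primrec.snd))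

/-- Adjacency of the nodes `u, v` in the graph on `n` nodes with code `x`. -/
def CodeAdj (n : ℕ) (x : List Bool) (u v : ℕ) : Prop :=
  x.getD ((edgePairs n).idxOf (min u v, max u v)) false = true

instance (n : ℕ) (x : List Bool) : DecidableRel (CodeAdj n x) :=
  fun _ _ => inferInstanceAs (Decidable (_ = true))

theorem primrecPred_codeAdj {α : Type} [Primcodable α] {n u v : α → ℕ} {x : α → List Bool}
    (hn : Primrec n) (hx : Primrec x) (hu : Primrec u) (hv : Primrec v) :
    PrimrecPred fun a => CodeAdj (n a) (x a) (u a) (v a) :=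
  Primrec.eq.comp ((Primrec.list_getD false).comp hx (primrec_list_idxOf.comp
    (Primrec.pair (Primrec.nat_min.comp hu hv) (Primrec.nat_max.comp hu hv))
    (primrec_edgePairs.comp hn))) (Primrec.const true)

open Classical in
theorem graphCode_eq_map_edgePairs {n : ℕ} (G : SimpleGraph (Fin n)) :
    graphCode G
      = (edgePairs n).map fun e => decide (∃ u v : Fin n, (u.val, v.val) = e ∧ G.Adj u v) := by
  rw [← map_edgeSlots, List.map_map]
  refine List.map_congr_left fun e _ => decide_eq_decide.2 ⟨fun h => ⟨e.1, e.2, rfl, h⟩, ?_⟩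
  rintro ⟨u, v, huv, h⟩
  obtain ⟨hu, hv⟩ := Prod.ext_iff.1 huv
  rwa [← Fin.ext hu, ← Fin.ext hv]

theorem codeAdj_graphCode {n : ℕ} (G : SimpleGraph (Fin n)) (u v : Fin n) :
    CodeAdj n (graphCode G) u v ↔ G.Adj u v := by
  wlog huv : u ≤ v generalizing u v
  · rw [G.adj_comm, ← this v u (le_of_not_ge huv), CodeAdj, CodeAdj, min_comm, max_comm]
  have hmin : min (u : ℕ) v = u := min_eq_left huv
  have hmax : max (u : ℕ) v = v := max_eq_right huv
  rw [CodeAdj, hmin, hmax, graphCode_eq_map_edgePairs, List.getD_eq_getElem?_getD,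
    List.getElem?_map]
  rcases huv.eq_or_lt with rfl | hlt
  · have hmem : ((u : ℕ), (u : ℕ)) ∉ edgePairs n := by simp [edgePairs]
    simp [List.idxOf_of_notMem hmem]
  · have hmem : ((u : ℕ), (v : ℕ)) ∈ edgePairs n :=
      map_edgeSlots n ▸ List.mem_map.2 ⟨(u, v), mem_edgeSlots.2 hlt, rfl⟩
    simp [List.getElem?_idxOf hmem, ← Fin.ext_iff, and_assoc]

end GraphCode

section Incompressibility

/-- A property of the labeled graphs on `n ≥ 1` nodes, uniformly in `n`, that a primitive recursive
test decides from `n` and the code of the graph. -/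
def IsPrimrecProperty (P : ∀ (n : ℕ) [NeZero n], SimpleGraph (Fin n) → Prop) : Prop :=
  ∃ T : ℕ → List Bool → Prop, PrimrecRel T ∧
    ∀ (n : ℕ) [NeZero n] (G : SimpleGraph (Fin n)), T n (graphCode G) ↔ P n G

theorem two_pow_clog_le {b : ℕ} (hb : b ≠ 0) : 2 ^ Nat.clog 2 b ≤ 2 * b := by
  rcases (Nat.one_le_iff_ne_zero.2 hb).eq_or_lt with rfl | hlt
  · simp
  · have hclog : Nat.clog 2 b ≠ 0 := (Nat.clog_pos one_lt_two hlt).ne'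
    rw [← Nat.succ_pred_eq_of_ne_zero hclog, pow_succ']
    exact Nat.mul_le_mul_left 2 (Nat.pow_pred_clog_lt_self one_lt_two hlt).le

variable {P : ∀ (n : ℕ) [NeZero n], SimpleGraph (Fin n) → Prop}

theorem IsPrimrecProperty.exists_two_pow_complexity_le (hP : IsPrimrecProperty P) :
    ∃ i : ℕ, ∀ (n d : ℕ) [NeZero n] (G : SimpleGraph (Fin n)), P n G →
      (2 : ℝ) ^ complexity (graphCode G) (n, d)
        ≤ 2 ^ i * (2 ^ n.choose 2 * randomGraphProb (P n)) := by
  classical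
  obtain ⟨T, hT, hTP⟩ := hP
  have hcodes : Primrec fun y : ℕ × ℕ =>
      (bitStrings (edgePairs y.1).length).filter (T y.1 ·) :=
    primrec_list_filter (p := fun y x => T y.1 x)
      (primrec_bitStrings.comp (Primrec.list_length.comp (primrec_edgePairs.comp Primrec.fst)))
      (hT.comp (Primrec.fst.comp Primrec.fst) Primrec.snd)
  obtain ⟨i, hi⟩ := exists_complexity_le_add_clog hcodes.to_comp
  refine ⟨i + 1, fun n d _ G hG => ?_⟩
  set codes := (bitStrings (edgePairs n).length).filter (T n ·) with hcodes_def
  have hmem : graphCode G ∈ codes := by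
    refine List.mem_filter.2 ⟨mem_bitStrings.2 ?_, decide_eq_true ((hTP n G).2 hG)⟩
    rw [graphCode, List.length_map, length_edgePairs]
  have hcard : (codes.length : ℝ) ≤ 2 ^ n.choose 2 * randomGraphProb (P n) := by
    rw [hcodes_def, length_edgePairs, length_filter_bitStrings_eq_mul_randomGraphProb, funext
      fun G => propext (hTP n G)]
    gcongr
    · exact randomGraphProb_nonneg _
    · exact one_le_two
    · exact length_edgeSlots_le n
  calc (2 : ℝ) ^ complexity (graphCode G) (n, d) ≤ 2 ^ (i + Nat.clog 2 codes.length) :=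
        pow_le_pow_right₀ one_le_two (hi (n, d) _ hmem)
    _ = 2 ^ i * (2 ^ Nat.clog 2 codes.length : ℕ) := by push_cast; rw [pow_add]
    _ ≤ 2 ^ i * (2 * codes.length : ℕ) := by
        gcongr
        exact two_pow_clog_le (List.length_pos_of_mem hmem).ne'
    _ ≤ 2 ^ (i + 1) * (2 ^ n.choose 2 * randomGraphProb (P n)) := by
        push_cast
        rw [pow_succ, mul_assoc]
        gcongr

theorem IsPrimrecProperty.eventually_not (hP : IsPrimrecProperty P) {δ q : ℕ → ℝ}
    (hq : ∀ᶠ n in atTop, ∀ [NeZero n], randomGraphProb (P n) ≤ q n)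
    (hδ : Tendsto (fun n => 2 ^ δ n * q n) atTop (𝓝 0)) :
    ∀ᶠ n in atTop, ∀ [NeZero n] (G : SimpleGraph (Fin n)), IsRandomGraph δ G → ¬ P n G := by
  obtain ⟨i, hi⟩ := hP.exists_two_pow_complexity_le
  filter_upwards [hq, (hδ.const_mul (2 ^ i)).eventually_lt_const (by simp : 2 ^ i * (0 : ℝ) < 1)]
    with n hqn hlt _ G hG hPG
  have hchoose : (n : ℝ) * (n - 1) / 2 = n.choose 2 := (Nat.cast_choose_two ℝ n).symm
  have hpow : (2 : ℝ) ^ n.choose 2 * 1 ≤ 2 ^ n.choose 2 * (2 ^ i * (2 ^ δ n * q n)) :=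
    calc (2 : ℝ) ^ n.choose 2 * 1 = 2 ^ δ n * 2 ^ ((n.choose 2 : ℝ) - δ n) := by
          rw [← Real.rpow_add two_pos, add_sub_cancel, Real.rpow_natCast, mul_one]
      _ ≤ 2 ^ δ n * 2 ^ complexity (graphCode G) (n, ⌊δ n⌋₊) := by
          rw [IsRandomGraph, hchoose] at hG
          rw [← Real.rpow_natCast 2 (complexity _ _)]
          gcongr
          exact one_le_two
      _ ≤ 2 ^ δ n * (2 ^ i * (2 ^ n.choose 2 * q n)) := by
          gcongr
          exact (hi n _ G hPG).trans (by gcongr; exact hqn)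
      _ = 2 ^ n.choose 2 * (2 ^ i * (2 ^ δ n * q n)) := by ring
  exact hlt.not_ge (le_of_mul_le_mul_left hpow (by positivity))

end Incompressibility

section RandomGraphBounds

variable {V : Type*}

theorem graphOfBits_piecewise_adj_left {r v : V} [∀ e, Decidable (e ∈ {e : Sym2 V | r ∈ e})]
    (ω' ω : Sym2 V → Bool) :
    (graphOfBits ({e | r ∈ e}.piecewise ω' ω)).Adj r v ↔ (graphOfBits ω').Adj r v := by
  rw [graphOfBits_adj, graphOfBits_adj, Set.piecewise_eq_of_mem _ _ _ (by simp)]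

theorem graphOfBits_piecewise_adj_of_ne {r u v : V}
    [∀ e, Decidable (e ∈ {e : Sym2 V | r ∈ e})] (hu : u ≠ r) (hv : v ≠ r) (ω' ω : Sym2 V → Bool) :
    (graphOfBits ({e | r ∈ e}.piecewise ω' ω)).Adj u v ↔ (graphOfBits ω).Adj u v := by
  rw [graphOfBits_adj, graphOfBits_adj,
    Set.piecewise_eq_of_notMem _ _ _ (by simp [hu.symm, hv.symm])]

variable [Fintype V] [DecidableEq V]

open Classical in
theorem expect_pow_degree_compl (x : ℝ) (r : V) :
    𝔼 ω : Sym2 V → Bool, x ^ (graphOfBits ω)ᶜ.degree r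
      = ((1 + x) / 2) ^ (Fintype.card V - 1) := by
  have hprod : ∀ ω : Sym2 V → Bool,
      x ^ (graphOfBits ω)ᶜ.degree r = ∏ v ∈ univ.erase r, if ω s(r, v) then 1 else x := by
    intro ω
    rw [prod_ite, prod_const_one, one_mul, prod_const, ← SimpleGraph.card_neighborFinset_eq_degree]
    congr 2
    ext v
    simp only [SimpleGraph.mem_neighborFinset, SimpleGraph.compl_adj, graphOfBits_adj, mem_filter,
      mem_erase, mem_univ, and_true]
    tauto
  simp only [hprod]
  rw [expect_prod_of_dependsOn (univ.erase r) (s := fun v => {s(r, v)})]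
  · simp only [expect_apply_bool _ fun b => if b then 1 else x, Bool.false_eq_true, if_true,
      if_false, prod_const, card_erase_of_mem (mem_univ r), card_univ]
  · exact fun v _ w _ hvw => Set.disjoint_singleton.2 fun h => hvw (Sym2.congr_right.1 h)
  · exact fun v _ => dependsOn_apply s(r, v) fun b : Bool => if b then 1 else x

open Classical in
theorem randomGraphProb_degree_compl_le (r : V) :
    randomGraphProb (fun G => 3 * Fintype.card V ≤ 4 * Gᶜ.degree r)
      ≤ (97 / 108) ^ Fintype.card V := by
  -- Chernoff bound: the Markov inequality for `x ^ degree`, where `x = (3 / 2) ^ 4` satisfies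
  -- `(1 + x) / 2 < x ^ (3 / 4)`.
  have hweight : ∀ G : SimpleGraph V, 3 * Fintype.card V ≤ 4 * Gᶜ.degree r →
      ((27 : ℝ) / 8) ^ Fintype.card V ≤ (81 / 16) ^ Gᶜ.degree r := by
    intro G hG
    rw [show (27 / 8 : ℝ) = (3 / 2) ^ 3 by norm_num, show (81 / 16 : ℝ) = (3 / 2) ^ 4 by norm_num,
      ← pow_mul, ← pow_mul]
    exact pow_le_pow_right₀ (by norm_num) hG
  calc randomGraphProb (fun G => 3 * Fintype.card V ≤ 4 * Gᶜ.degree r)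
      ≤ ((1 + 81 / 16) / 2) ^ (Fintype.card V - 1) / (27 / 8) ^ Fintype.card V := by
        rw [← expect_pow_degree_compl _ r]
        exact randomGraphProb_le_expect_div (W := fun G => (81 / 16) ^ Gᶜ.degree r)
          (by positivity) (fun G => by positivity) hweight
    _ ≤ ((1 + 81 / 16) / 2) ^ Fintype.card V / (27 / 8) ^ Fintype.card V := by
        gcongr
        · norm_num
        · exact Nat.sub_le _ _
    _ = (97 / 108) ^ Fintype.card V := by rw [← div_pow]; norm_num

theorem randomGraphProb_no_common_neighbour_le {r u : V} (hur : u ≠ r) (S : Finset V) :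
    randomGraphProb (fun G => ∀ v ∈ S, ¬ (G.Adj r v ∧ G.Adj u v)) ≤ (3 / 4) ^ (#S - 2) := by
  classical
  set T := (S.erase r).erase u
  have hT : ∀ v ∈ T, v ≠ u ∧ v ≠ r ∧ v ∈ S := fun v hv => by simpa [T] using hv
  have hcard : #S - 2 ≤ #T := by
    have h₁ := pred_card_le_card_erase (s := S) (a := r)
    have h₂ := pred_card_le_card_erase (s := S.erase r) (a := u)
    lia
  have hmean : ∀ v, 𝔼 ω : Sym2 V → Bool, (1 - (if ω s(r, v) then 1 else 0) *
      (if ω s(u, v) then 1 else 0) : ℝ) = 3 / 4 := by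
    intro v
    rw [expect_sub_distrib, Fintype.expect_const,
      expect_mul_of_dependsOn
        (Set.disjoint_singleton.2 fun h => hur.symm (Sym2.congr_left.1 h))
        (dependsOn_apply s(r, v) fun b : Bool => if b then (1 : ℝ) else 0)
        (dependsOn_apply s(u, v) fun b : Bool => if b then (1 : ℝ) else 0),
      expect_apply_bool _ fun b => if b then 1 else 0,
      expect_apply_bool _ fun b => if b then 1 else 0]
    norm_num
  calc randomGraphProb (fun G => ∀ v ∈ S, ¬ (G.Adj r v ∧ G.Adj u v))
      ≤ 𝔼 ω : Sym2 V → Bool, ∏ v ∈ T, (1 - (if ω s(r, v) then 1 else 0) *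
          (if ω s(u, v) then 1 else 0) : ℝ) := by
        refine expect_le_expect fun ω _ => ?_
        split_ifs with h
        · refine (prod_eq_one fun v hv => ?_).ge
          obtain ⟨hvu, hvr, hvS⟩ := hT v hv
          have := h v hvS
          simp only [graphOfBits_adj] at this
          grind
        · exact prod_nonneg fun v _ => by split_ifs <;> norm_num
    _ = (3 / 4) ^ #T := by
        rw [expect_prod_of_dependsOn T (s := fun v => {s(r, v), s(u, v)}),
          prod_congr rfl fun v _ => hmean v, prod_const]
        · intro v hv w hw hvw
          have := hT v hv
          have := hT w hw
          simp only [Function.onFun, Set.disjoint_insert_right, Set.disjoint_singleton_right,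
            Set.mem_insert_iff, Set.mem_singleton_iff, Sym2.eq_iff]
          grind
        · intro v _ x y h
          simp only [h s(r, v) (by simp), h s(u, v) (by simp)]
    _ ≤ (3 / 4) ^ (#S - 2) := pow_le_pow_of_le_one (by norm_num) (by norm_num) hcard

/-- Every node other than `r` has a common neighbour with `r` in `S`. -/
def LinkedThrough (G : SimpleGraph V) (r : V) (S : Finset V) : Prop :=
  ∀ u, u ≠ r → ∃ v ∈ S, G.Adj r v ∧ G.Adj u v

theorem randomGraphProb_not_linkedThrough_le (r : V) (S : Finset V) :
    randomGraphProb (fun G => ¬ LinkedThrough G r S) ≤ Fintype.card V * (3 / 4) ^ (#S - 2) := by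
  have hexists : ∀ G, ¬ LinkedThrough G r S ↔
      ∃ u : {u // u ≠ r}, ∀ v ∈ S, ¬ (G.Adj r v ∧ G.Adj u v) := by
    simp [LinkedThrough]
  simp only [hexists]
  calc randomGraphProb (fun G => ∃ u : {u // u ≠ r}, ∀ v ∈ S, ¬ (G.Adj r v ∧ G.Adj u v))
      ≤ ∑ _u : {u // u ≠ r}, (3 / 4 : ℝ) ^ (#S - 2) :=
        (randomGraphProb_exists_le _).trans
          (sum_le_sum fun u _ => randomGraphProb_no_common_neighbour_le u.2 S)
    _ ≤ Fintype.card V * (3 / 4) ^ (#S - 2) := by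
        rw [sum_const, nsmul_eq_mul, card_univ]
        gcongr
        exact Fintype.card_subtype_le _

end RandomGraphBounds

section RoutingTable

variable {n : ℕ}

open Classical in
/-- The neighbours of `u` in increasing order. -/
noncomputable def neighbours (G : SimpleGraph (Fin n)) (u : Fin n) : List (Fin n) :=
  (List.finRange n).filter (G.Adj u ·)

theorem mem_neighbours {G : SimpleGraph (Fin n)} {u v : Fin n} :
    v ∈ neighbours G u ↔ G.Adj u v := by
  simp [neighbours]

theorem nodup_neighbours (G : SimpleGraph (Fin n)) (u : Fin n) : (neighbours G u).Nodup :=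
  (List.nodup_finRange n).filter _

open Classical in
/-- The entry for the destination `w` in the routing table of `r`: the index, among the neighbours
of `r`, of the first one that is adjacent to `w`. It is `0` where no entry is needed. -/
noncomputable def tableEntry (G : SimpleGraph (Fin n)) (r w : Fin n) : ℕ :=
  if w = r ∨ G.Adj r w then 0 else (neighbours G r).findIdx (G.Adj w ·)

/-- The number of bits of the routing table of `r` when each entry `j` is written as `1^j 0`. -/
noncomputable def tableLength (G : SimpleGraph (Fin n)) (r : Fin n) : ℕ :=
  ∑ w, (tableEntry G r w + 1)

open Classical in
/-- The edges from `w` to the neighbours of `r`, in the order in which the table entry for `w`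
inspects them. -/
noncomputable def tableProbes (G : SimpleGraph (Fin n)) (r w : Fin n) : List (Sym2 (Fin n)) :=
  if w = r ∨ G.Adj r w then [] else (neighbours G r).map (s(w, ·))

theorem mem_tableProbes {G : SimpleGraph (Fin n)} {r w : Fin n} {e : Sym2 (Fin n)} :
    e ∈ tableProbes G r w ↔ (w ≠ r ∧ ¬ G.Adj r w) ∧ ∃ v, G.Adj r v ∧ s(w, v) = e := by
  unfold tableProbes
  split_ifs with h
  · simp only [List.not_mem_nil, false_iff]
    tauto
  · simp [mem_neighbours, not_or.1 h]

theorem nodup_tableProbes (G : SimpleGraph (Fin n)) (r w : Fin n) : (tableProbes G r w).Nodup := by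
  unfold tableProbes
  split_ifs
  · exact List.nodup_nil
  · exact (nodup_neighbours G r).map fun _ _ h => Sym2.congr_right.1 h

theorem disjoint_tableProbes (G : SimpleGraph (Fin n)) (r : Fin n) {w w' : Fin n} (h : w ≠ w') :
    Disjoint {e | e ∈ tableProbes G r w} {e | e ∈ tableProbes G r w'} := by
  refine Set.disjoint_left.2 fun e he he' => ?_
  obtain ⟨-, v, hv, rfl⟩ := mem_tableProbes.1 he
  obtain ⟨⟨-, hw'⟩, v', -, hv'⟩ := mem_tableProbes.1 he'
  rcases Sym2.eq_iff.1 hv' with ⟨rfl, -⟩ | ⟨rfl, -⟩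
  · exact h rfl
  · exact hw' hv

theorem tableEntry_graphOfBits_piecewise (ω' ω : Sym2 (Fin n) → Bool) (r w : Fin n) :
    tableEntry (graphOfBits ({e | r ∈ e}.piecewise ω' ω)) r w
      = (tableProbes (graphOfBits ω') r w).findIdx ω := by
  have hadj : (graphOfBits ({e | r ∈ e}.piecewise ω' ω)).Adj r = (graphOfBits ω').Adj r :=
    funext fun v => propext (graphOfBits_piecewise_adj_left ω' ω)
  rw [tableEntry, tableProbes, neighbours, neighbours, hadj]
  split_ifs with hw
  · rfl
  · obtain ⟨hwr, hrw⟩ := not_or.1 hw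
    rw [List.findIdx_map]
    refine list_findIdx_congr fun v hv => ?_
    have hrv : (graphOfBits ω').Adj r v := mem_neighbours.1 hv
    have hwv : w ≠ v := by rintro rfl; exact hrw hrv
    simp [graphOfBits_piecewise_adj_of_ne hwr hrv.ne', graphOfBits_adj, hwv]

/-- Once the neighbours of `r` are known, the table entries inspect disjoint sets of edges, and
each entry is the number of failures before the first success. -/
theorem expect_pow_tableLength_le {x : ℝ} (hx : 1 ≤ x) (hx2 : x < 2) (r : Fin n) :
    𝔼 ω, x ^ tableLength (graphOfBits ω) r ≤ (x / (2 - x)) ^ n := by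
  classical
  rw [expect_eq_expect_expect_piecewise {e | r ∈ e},
    ← Fintype.expect_const (ι := Sym2 (Fin n) → Bool) ((x / (2 - x)) ^ n)]
  refine expect_le_expect fun ω' _ => ?_
  let probes := tableProbes (graphOfBits ω') r
  calc 𝔼 ω, x ^ tableLength (graphOfBits ({e | r ∈ e}.piecewise ω' ω)) r
      = 𝔼 ω : Sym2 (Fin n) → Bool, ∏ w, x ^ ((probes w).findIdx ω + 1) := by
        simp only [tableLength, tableEntry_graphOfBits_piecewise, prod_pow_eq_pow_sum, probes]
    _ = ∏ w, 𝔼 ω : Sym2 (Fin n) → Bool, x ^ ((probes w).findIdx ω + 1) := by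
        refine expect_prod_of_dependsOn univ (s := fun w => {e | e ∈ probes w})
          (fun w _ w' _ h => disjoint_tableProbes _ r h) fun w _ ω₁ ω₂ h => ?_
        simp only [dependsOn_findIdx (probes w) h]
    _ ≤ ∏ _w : Fin n, x / (2 - x) := by
        refine prod_le_prod (fun w _ => expect_nonneg fun ω _ => by positivity) fun w _ => ?_
        exact expect_pow_findIdx_le hx hx2 (nodup_tableProbes _ r w)
    _ = (x / (2 - x)) ^ n := by rw [prod_const, card_univ, Fintype.card_fin]

theorem randomGraphProb_tableLength_le (K : ℕ) (r : Fin n) :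
    randomGraphProb (fun G => 3 * n < tableLength G r + K) ≤ (4 / 3) ^ K * (27 / 32) ^ n := by
  have hweight : ∀ G : SimpleGraph (Fin n), 3 * n < tableLength G r + K →
      ((4 : ℝ) / 3) ^ (3 * n) ≤ (4 / 3) ^ tableLength G r * (4 / 3) ^ K := fun G hG => by
    rw [← pow_add]
    exact pow_le_pow_right₀ (by norm_num) hG.le
  calc randomGraphProb (fun G => 3 * n < tableLength G r + K)
      ≤ (𝔼 ω, (4 / 3) ^ tableLength (graphOfBits ω) r * (4 / 3) ^ K) / (4 / 3) ^ (3 * n) :=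
        randomGraphProb_le_expect_div (W := fun G => (4 / 3) ^ tableLength G r * (4 / 3) ^ K)
          (by positivity) (fun G => by positivity) hweight
    _ ≤ ((4 / 3) / (2 - 4 / 3)) ^ n * (4 / 3) ^ K / (4 / 3) ^ (3 * n) := by
        rw [← expect_mul]
        gcongr
        exact expect_pow_tableLength_le (by norm_num) (by norm_num) r
    _ = (4 / 3) ^ K * (27 / 32) ^ n := by
        rw [pow_mul, mul_comm, mul_div_assoc, ← div_pow]
        norm_num

end RoutingTable

section PrimrecProperties

variable {α : Type} [Primcodable α] {n u v : α → ℕ} {x : α → List Bool}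

/-- The neighbours of the node `u` in the graph on `n` nodes with code `x`. -/
def codeNeighbours (n : ℕ) (x : List Bool) (u : ℕ) : List ℕ :=
  (List.range n).filter (CodeAdj n x u ·)

theorem codeNeighbours_graphCode {n : ℕ} (G : SimpleGraph (Fin n)) (u : Fin n) :
    codeNeighbours n (graphCode G) u = (neighbours G u).map Fin.val := by
  rw [codeNeighbours, neighbours, ← List.map_coe_finRange_eq_range, List.filter_map]
  exact congrArg (List.map Fin.val)
    (List.filter_congr fun v _ => decide_eq_decide.2 (codeAdj_graphCode G u v))

theorem primrec_codeNeighbours (hn : Primrec n) (hx : Primrec x) (hu : Primrec u) :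
    Primrec fun a => codeNeighbours (n a) (x a) (u a) :=
  primrec_list_filter (Primrec.list_range.comp hn) (primrecPred_codeAdj (hn.comp Primrec.fst)
    (hx.comp Primrec.fst) (hu.comp Primrec.fst) Primrec.snd)

/-- The entry for `v` in the routing table of `u`, in the graph on `n` nodes with code `x`. -/
def codeTableEntry (n : ℕ) (x : List Bool) (u v : ℕ) : ℕ :=
  if v = u ∨ CodeAdj n x u v then 0 else (codeNeighbours n x u).findIdx (CodeAdj n x v ·)

theorem codeTableEntry_graphCode {n : ℕ} (G : SimpleGraph (Fin n)) (u v : Fin n) :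
    codeTableEntry n (graphCode G) u v = tableEntry G u v := by
  rw [codeTableEntry, tableEntry, codeNeighbours_graphCode, List.findIdx_map]
  congr 1
  · rw [Fin.val_inj, codeAdj_graphCode]
  · exact list_findIdx_congr fun w _ => decide_eq_decide.2 (codeAdj_graphCode G v w)

theorem primrec_codeTableEntry (hn : Primrec n) (hx : Primrec x) (hu : Primrec u)
    (hv : Primrec v) : Primrec fun a => codeTableEntry (n a) (x a) (u a) (v a) :=
  Primrec.ite ((Primrec.eq.comp hv hu).or (primrecPred_codeAdj hn hx hu hv)) (Primrec.const 0)
    (Primrec.list_findIdx (primrec_codeNeighbours hn hx hu) (primrecPred_codeAdj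
      (hn.comp Primrec.fst) (hx.comp Primrec.fst) (hv.comp Primrec.fst) Primrec.snd).decide)

open Classical in
theorem isPrimrecProperty_degree_compl :
    IsPrimrecProperty fun n _ G => 3 * n ≤ 4 * Gᶜ.degree 0 := by
  refine ⟨fun n x => 3 * n ≤ 4 * (n - 1 - (codeNeighbours n x 0).length), ?_, fun n _ G => ?_⟩
  · exact Primrec.nat_le.comp (Primrec.nat_mul.comp (Primrec.const 3) Primrec.fst)
      (Primrec.nat_mul.comp (Primrec.const 4) (Primrec.nat_sub.comp (Primrec.pred.comp Primrec.fst)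
        (Primrec.list_length.comp
          (primrec_codeNeighbours Primrec.fst Primrec.snd (Primrec.const 0)))))
  · have hdegree : (codeNeighbours n (graphCode G) 0).length = G.degree 0 := by
      rw [← Fin.val_zero n, codeNeighbours_graphCode, List.length_map,
        ← List.toFinset_card_of_nodup (nodup_neighbours G 0)]
      congr 1
      ext v
      simp [mem_neighbours]
    beta_reduce
    rw [hdegree, SimpleGraph.degree_compl, Fintype.card_fin]

theorem isPrimrecProperty_tableLength (K : ℕ) :
    IsPrimrecProperty fun n _ G => 3 * n < tableLength G 0 + K := by
  refine ⟨fun n x => 3 * n < ((List.range n).map fun w => codeTableEntry n x 0 w + 1).sum + K,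
    ?_, fun n _ G => ?_⟩
  · exact Primrec.nat_lt.comp (Primrec.nat_mul.comp (Primrec.const 3) Primrec.fst)
      (Primrec.nat_add.comp (primrec_list_sum_map (Primrec.list_range.comp Primrec.fst)
        (Primrec.succ.comp (primrec_codeTableEntry (Primrec.fst.comp Primrec.fst)
          (Primrec.snd.comp Primrec.fst) (Primrec.const 0) Primrec.snd))) (Primrec.const K))
  · beta_reduce
    rw [tableLength, Fin.sum_univ_def, ← List.map_coe_finRange_eq_range, List.map_map]
    simp only [Function.comp_def, ← codeTableEntry_graphCode, Fin.val_zero]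

theorem isPrimrecProperty_not_linkedThrough {L : ℕ → ℕ} (hL : Primrec L) :
    IsPrimrecProperty fun n _ G => ¬ LinkedThrough G 0 {v | (v : ℕ) < L n} := by
  refine ⟨fun n x => ¬ ∀ u ∈ List.range n, u = 0 ∨ ∃ v ∈ List.range n,
    v < L n ∧ CodeAdj n x 0 v ∧ CodeAdj n x u v, ?_, fun n _ G => not_congr ?_⟩
  · have hlink : PrimrecRel fun (v : ℕ) (z : ℕ × ℕ × List Bool) =>
        v < L z.2.1 ∧ CodeAdj z.2.1 z.2.2 0 v ∧ CodeAdj z.2.1 z.2.2 z.1 v := by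
      have hn : Primrec fun a : ℕ × ℕ × ℕ × List Bool => a.2.2.1 :=
        Primrec.fst.comp (Primrec.snd.comp Primrec.snd)
      have hx : Primrec fun a : ℕ × ℕ × ℕ × List Bool => a.2.2.2 :=
        Primrec.snd.comp (Primrec.snd.comp Primrec.snd)
      exact (Primrec.nat_lt.comp Primrec.fst (hL.comp hn)).and
        ((primrecPred_codeAdj hn hx (Primrec.const 0) Primrec.fst).and
          (primrecPred_codeAdj hn hx (Primrec.fst.comp Primrec.snd) Primrec.fst))
    have hnode : PrimrecRel fun (u : ℕ) (z : ℕ × List Bool) => u = 0 ∨ ∃ v ∈ List.range z.1,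
        v < L z.1 ∧ CodeAdj z.1 z.2 0 v ∧ CodeAdj z.1 z.2 u v :=
      (Primrec.eq.comp Primrec.fst (Primrec.const 0)).or (hlink.exists_mem_list.comp
        (Primrec.list_range.comp (Primrec.fst.comp Primrec.snd)) Primrec.id)
    exact (hnode.forall_mem_list.comp (Primrec.list_range.comp Primrec.fst) Primrec.id).not
  · have hadj : ∀ u v : Fin n, CodeAdj n (graphCode G) u v ↔ G.Adj u v := codeAdj_graphCode G
    simp only [LinkedThrough, ← hadj, Fin.val_zero, Fin.forall_iff, Fin.exists_iff, exists_prop,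
      List.mem_range, mem_filter, mem_univ, true_and, ← Fin.val_eq_zero_iff, ne_eq,
      or_iff_not_imp_left]

end PrimrecProperties

section RoutingPrograms

/-- The string of the blocks `1^j 0`, for the members `j` of a list. -/
def unaryTable (l : List ℕ) : List Bool := l.flatMap fun j => List.replicate j true ++ [false]

/-- The length of the `k`-th block of ones in a binary string. -/
def unaryBlock (k : ℕ) (p : List Bool) : ℕ :=
  (((fun q : List Bool => (q.dropWhile fun b => b).tail)^[k] p).takeWhile fun b => b).length

theorem length_unaryTable (l : List ℕ) : (unaryTable l).length = (l.map (· + 1)).sum := by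
  simp [unaryTable, List.length_flatMap]

theorem unaryBlock_unaryTable {l : List ℕ} {k : ℕ} (hk : k < l.length) :
    unaryBlock k (unaryTable l) = l[k] := by
  induction l generalizing k with
  | nil => exact absurd hk (Nat.not_lt_zero k)
  | cons j l ih =>
    have hcons : unaryTable (j :: l) = List.replicate j true ++ false :: unaryTable l := by
      simp [unaryTable]
    cases k with
    | zero => simp [unaryBlock, hcons]
    | succ k =>
      rw [List.getElem_cons_succ, ← ih (Nat.lt_of_succ_lt_succ hk), unaryBlock, unaryBlock,
        Function.iterate_succ_apply, hcons]
      simp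

theorem primrec_unaryBlock : Primrec₂ unaryBlock :=
  Primrec.list_length.comp ((Primrec.list_takeWhile Primrec.id).comp
    (Primrec.nat_iterate Primrec.fst Primrec.snd
      (Primrec.list_tail.comp ((Primrec.list_dropWhile Primrec.id).comp Primrec.snd)).to₂))

/-- A local routing function that keeps a string `p` in storage: a message goes to its destination
`w` if that is a neighbour, and otherwise to the neighbour at the position `idx p w`. -/
def storedNext (idx : List Bool → ℕ → ℕ) (z : List Bool × ℕ × List ℕ × ℕ) : ℕ :=
  if z.2.2.2 ∈ z.2.2.1 then z.2.2.2 else z.2.2.1.getD (idx z.1 z.2.2.2) 0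

theorem primrec_storedNext {idx : List Bool → ℕ → ℕ} (hidx : Primrec₂ idx) :
    Primrec (storedNext idx) := by
  have hlabels : Primrec fun z : List Bool × ℕ × List ℕ × ℕ => z.2.2.1 :=
    Primrec.fst.comp (Primrec.snd.comp Primrec.snd)
  have hdest : Primrec fun z : List Bool × ℕ × List ℕ × ℕ => z.2.2.2 :=
    Primrec.snd.comp (Primrec.snd.comp Primrec.snd)
  have hmem : PrimrecPred fun z : List Bool × ℕ × List ℕ × ℕ => z.2.2.2 ∈ z.2.2.1 :=
    (Primrec.eq.exists_mem_list.comp hlabels hdest).of_eq fun z => exists_eq_right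
  exact Primrec.ite hmem hdest
    ((Primrec.list_getD 0).comp hlabels (hidx.comp Primrec.fst hdest))

theorem exists_program_storedBy {idx : List Bool → ℕ → ℕ} (hidx : Primrec₂ idx) :
    ∃ i, ∀ {n : ℕ} {G : SimpleGraph (Fin n)} (F : RoutingScheme G) (u : Fin n) (p : List Bool),
      (∀ w, G.Adj u w → F.next u w = w) →
      (∀ w, w ≠ u → ¬ G.Adj u w → (neighbours G u)[idx p (label w)]? = some (F.next u w)) →
      F.StoredBy u (program i p) := by
  obtain ⟨i, hi⟩ := exists_program_computes (primrec_storedNext hidx).to_comp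
  refine ⟨i, fun {n G} F u p hadj hidx w hwu => hi _ _ _ (Part.mem_some_iff.2 ?_)⟩
  have hlabels : neighbourLabels G u = (neighbours G u).map label := rfl
  have hmem : label w ∈ neighbourLabels G u ↔ G.Adj u w := by
    simp [hlabels, label, mem_neighbours, Fin.val_inj]
  by_cases h : G.Adj u w
  · rw [storedNext, if_pos (hmem.2 h), hadj w h]
  · rw [storedNext, if_neg (mt hmem.1 h), hlabels, List.getD_eq_getElem?_getD, List.getElem?_map,
      hidx w hwu h]
    rfl

end RoutingPrograms

section Routes

variable {n : ℕ} {G : SimpleGraph (Fin n)} {F : RoutingScheme G} {u w : Fin n} {m : ℕ}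

theorem RoutingScheme.Route.reachable (h : F.Route w u m) : G.Reachable u w := by
  induction h with
  | arrived => exact SimpleGraph.Reachable.refl _
  | hop h _ ih => exact (F.adj_next _ _ h).reachable.trans ih

/-- A message for `w` that is at `u` reaches `w` after at most `m` hops. -/
def RoutingScheme.DeliversWithin (F : RoutingScheme G) (u w : Fin n) (m : ℕ) : Prop :=
  ∃ k ≤ m, F.Route w u k

theorem RoutingScheme.deliversWithin_self (F : RoutingScheme G) (w : Fin n) (m : ℕ) :
    F.DeliversWithin w w m :=
  ⟨0, Nat.zero_le m, .arrived⟩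

theorem RoutingScheme.DeliversWithin.mono {m' : ℕ} (h : F.DeliversWithin u w m) (hm : m ≤ m') :
    F.DeliversWithin u w m' :=
  h.imp fun _ hk => ⟨hk.1.trans hm, hk.2⟩

theorem RoutingScheme.DeliversWithin.hop (h : F.DeliversWithin (F.next u w) w m) :
    F.DeliversWithin u w (m + 1) := by
  rcases eq_or_ne u w with rfl | huw
  · exact F.deliversWithin_self u (m + 1)
  · exact h.elim fun k hk => ⟨k + 1, Nat.succ_le_succ hk.1, .hop huw hk.2⟩

theorem RoutingScheme.stretchAtMost_of_deliversWithin {s : ℕ}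
    (hadj : ∀ u w, G.Adj u w → F.DeliversWithin u w s)
    (hall : ∀ u w, F.DeliversWithin u w (s * 2)) : F.StretchAtMost s := by
  suffices h : ∀ u w, u ≠ w → ∃ k, F.Route w u k ∧ k ≤ s * G.dist u w from
    fun u w huw => (h u w huw).imp fun k hk => ⟨hk.1, by exact_mod_cast hk.2⟩
  intro u w huw
  by_cases huw_adj : G.Adj u w
  · obtain ⟨k, hk, hroute⟩ := hadj u w huw_adj
    exact ⟨k, hroute, by rwa [SimpleGraph.dist_eq_one_iff_adj.2 huw_adj, mul_one]⟩
  · obtain ⟨k, hk, hroute⟩ := hall u w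
    have hdist₀ : G.dist u w ≠ 0 := (hroute.reachable.pos_dist_of_ne huw).ne'
    have hdist₁ : G.dist u w ≠ 1 := mt SimpleGraph.dist_eq_one_iff_adj.1 huw_adj
    exact ⟨k, hroute, hk.trans (Nat.mul_le_mul_left s (by lia))⟩

end Routes

section HubScheme

variable {n : ℕ} {G : SimpleGraph (Fin n)} {r : Fin n} {up down : Fin n → Fin n}

/-- `f` sends every node at distance at least `2` from `r` to a common neighbour of it and `r`. -/
def IsRelay (G : SimpleGraph (Fin n)) (r : Fin n) (f : Fin n → Fin n) : Prop :=
  ∀ u, u ≠ r → ¬ G.Adj r u → G.Adj r (f u) ∧ G.Adj u (f u)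

open Classical in
/-- Routing via the hub `r`: a message whose destination is not in sight goes up to `r`, if
necessary through the relay `up`, and from there down to its destination `w` through the relay
`down w`. -/
noncomputable def hubScheme (hup : IsRelay G r up) (hdown : IsRelay G r down) :
    RoutingScheme G where
  next u w := if G.Adj u w then w else if u = r then down w else if G.Adj r u then r else up u
  adj_next u w huw := by
    split_ifs with hadj hur hru
    · exact hadj
    · subst hur
      exact (hdown w huw.symm hadj).1
    · exact hru.symm
    · exact (hup u hur hru).2

variable (hup : IsRelay G r up) (hdown : IsRelay G r down) {u w : Fin n}

theorem hubScheme_next_of_adj (h : G.Adj u w) : (hubScheme hup hdown).next u w = w :=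
  if_pos h

theorem hubScheme_next_hub (h : ¬ G.Adj r w) : (hubScheme hup hdown).next r w = down w := by
  simp [hubScheme, h]

open Classical in
theorem hubScheme_next_of_not_adj (hu : u ≠ r) (h : ¬ G.Adj u w) :
    (hubScheme hup hdown).next u w = if G.Adj r u then r else up u := by
  simp [hubScheme, h, hu]

theorem hubScheme_deliversWithin_of_adj (h : G.Adj u w) :
    (hubScheme hup hdown).DeliversWithin u w 1 := by
  refine .hop ?_
  rw [hubScheme_next_of_adj hup hdown h]
  exact RoutingScheme.deliversWithin_self _ w 0

theorem hubScheme_deliversWithin_two_of_hub :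
    (hubScheme hup hdown).DeliversWithin r w 2 := by
  rcases eq_or_ne w r with rfl | hw
  · exact RoutingScheme.deliversWithin_self _ w 2
  by_cases h : G.Adj r w
  · exact (hubScheme_deliversWithin_of_adj hup hdown h).mono one_le_two
  · refine .hop ?_
    rw [hubScheme_next_hub hup hdown h]
    exact hubScheme_deliversWithin_of_adj hup hdown (hdown w hw h).2.symm

theorem hubScheme_deliversWithin_three_of_adj_hub (hu : G.Adj r u) :
    (hubScheme hup hdown).DeliversWithin u w 3 := by
  by_cases h : G.Adj u w
  · exact (hubScheme_deliversWithin_of_adj hup hdown h).mono (by norm_num)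
  · refine .hop ?_
    rw [hubScheme_next_of_not_adj hup hdown hu.ne' h, if_pos hu]
    exact hubScheme_deliversWithin_two_of_hub hup hdown

theorem hubScheme_deliversWithin_four (u w : Fin n) :
    (hubScheme hup hdown).DeliversWithin u w 4 := by
  rcases eq_or_ne u r with rfl | hu
  · exact (hubScheme_deliversWithin_two_of_hub hup hdown).mono (by norm_num)
  by_cases hru : G.Adj r u
  · exact (hubScheme_deliversWithin_three_of_adj_hub hup hdown hru).mono (by norm_num)
  by_cases h : G.Adj u w
  · exact (hubScheme_deliversWithin_of_adj hup hdown h).mono (by norm_num)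
  · refine .hop ?_
    rw [hubScheme_next_of_not_adj hup hdown hu h, if_neg hru]
    exact hubScheme_deliversWithin_three_of_adj_hub hup hdown (hup u hu hru).1

theorem hubScheme_stretchAtMost_two : (hubScheme hup hdown).StretchAtMost 2 :=
  RoutingScheme.stretchAtMost_of_deliversWithin
    (fun _ _ h => (hubScheme_deliversWithin_of_adj hup hdown h).mono one_le_two)
    (hubScheme_deliversWithin_four hup hdown)

end HubScheme

section Storage

variable {n : ℕ} {G : SimpleGraph (Fin n)}

theorem le_val_getElem_neighbours {u : Fin n} {k : ℕ} (hk : k < (neighbours G u).length) :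
    k ≤ ((neighbours G u)[k] : ℕ) := by
  have hsorted : (neighbours G u).Pairwise (· < ·) := (List.pairwise_lt_finRange n).filter _
  induction k with
  | zero => exact Nat.zero_le _
  | succ k ih =>
    have hk' : k < (neighbours G u).length := Nat.lt_of_succ_lt hk
    have hlt := List.pairwise_iff_getElem.1 hsorted k (k + 1) hk' hk k.lt_succ_self
    exact Nat.succ_le_of_lt ((ih hk').trans_lt hlt)

theorem exists_getElem?_neighbours {u v : Fin n} (h : G.Adj u v) :
    ∃ k ≤ (v : ℕ), (neighbours G u)[k]? = some v := by
  obtain ⟨k, hk, rfl⟩ := List.getElem_of_mem (mem_neighbours.2 h)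
  exact ⟨k, le_val_getElem_neighbours hk, List.getElem?_eq_getElem hk⟩

theorem exists_getElem?_tableEntry {r w : Fin n} (hw : w ≠ r) (hrw : ¬ G.Adj r w)
    (h : ∃ v, G.Adj r v ∧ G.Adj w v) :
    ∃ v, (G.Adj r v ∧ G.Adj w v) ∧ (neighbours G r)[tableEntry G r w]? = some v := by
  classical
  obtain ⟨v, hrv, hwv⟩ := h
  have hlt : (neighbours G r).findIdx (G.Adj w ·) < (neighbours G r).length :=
    List.findIdx_lt_length.2 ⟨v, mem_neighbours.2 hrv, decide_eq_true hwv⟩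
  rw [tableEntry, if_neg (not_or.2 ⟨hw, hrw⟩)]
  exact ⟨_, ⟨mem_neighbours.1 (List.getElem_mem hlt), of_decide_eq_true
    (List.findIdx_getElem (w := hlt))⟩, List.getElem?_eq_getElem hlt⟩

theorem exists_program_hub_storedBy :
    ∃ j, ∀ {n : ℕ} {G : SimpleGraph (Fin n)} {r : Fin n} {up down : Fin n → Fin n}
      (hup : IsRelay G r up) (hdown : IsRelay G r down),
      (∀ w, w ≠ r → ¬ G.Adj r w → (neighbours G r)[tableEntry G r w]? = some (down w)) →
      ∃ p : List Bool, p.length = j + tableLength G r ∧ (hubScheme hup hdown).StoredBy r p := by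
  obtain ⟨j, hj⟩ := exists_program_storedBy (idx := fun p w => unaryBlock (w - 1) p)
    (primrec_unaryBlock.comp (Primrec.pred.comp Primrec.snd) Primrec.fst)
  refine ⟨j + 1, fun {n G r up down} hup hdown htable =>
    ⟨program j (unaryTable ((List.finRange n).map (tableEntry G r))), ?_, ?_⟩⟩
  · rw [length_program, length_unaryTable, tableLength, Fin.sum_univ_def, List.map_map]
    rfl
  · refine hj _ _ _ (fun w h => hubScheme_next_of_adj hup hdown h) fun w hw h => ?_
    rw [hubScheme_next_hub hup hdown h, ← htable w hw h, label, Nat.add_sub_cancel,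
      unaryBlock_unaryTable (by simp)]
    simp

open Classical in
theorem exists_program_node_storedBy :
    ∃ i, ∀ {n : ℕ} {G : SimpleGraph (Fin n)} {r : Fin n} {up down : Fin n → Fin n}
      (hup : IsRelay G r up) (hdown : IsRelay G r down) {u : Fin n} {b k : ℕ}, u ≠ r → k < 2 ^ b →
      (neighbours G u)[k]? = some (if G.Adj r u then r else up u) →
      ∃ p : List Bool, p.length = i + b ∧ (hubScheme hup hdown).StoredBy u p := by
  obtain ⟨i, hi⟩ := exists_program_storedBy (idx := fun p _ => bitIndex p)
    (primrec_bitIndex.comp Primrec.fst)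
  refine ⟨i + 1, fun {n G r up down} hup hdown {u b k} hu hkb hk => ?_⟩
  obtain ⟨p, rfl, rfl⟩ := exists_bitIndex_eq hkb
  refine ⟨program i p, length_program i p, hi _ _ _ (fun w h => hubScheme_next_of_adj hup hdown h)
    fun w _ h => ?_⟩
  rw [hubScheme_next_of_not_adj hup hdown hu h, hk]

open Classical in
theorem exists_routingScheme_storedBy :
    ∃ i j, ∀ (n L : ℕ) [NeZero n] (G : SimpleGraph (Fin n)),
      LinkedThrough G 0 {v | (v : ℕ) < L} →
      ∃ (F : RoutingScheme G) (store : Fin n → List Bool), F.StretchAtMost 2 ∧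
        (∀ v, F.StoredBy v (store v)) ∧ (store 0).length = j + tableLength G 0 ∧
        ∀ v, v ≠ 0 → (store v).length = i + if G.Adj 0 v then 0 else Nat.clog 2 L := by
  obtain ⟨i, hi⟩ := exists_program_node_storedBy
  obtain ⟨j, hj⟩ := exists_program_hub_storedBy
  refine ⟨i, j, fun n L _ G hG => ?_⟩
  have hdown := fun w hw hrw => exists_getElem?_tableEntry (G := G) (r := 0) (w := w) hw hrw
    ((hG w hw).imp fun v => And.right)
  choose! down down_relay down_entry using hdown
  have hup : ∀ u, u ≠ 0 → ¬ G.Adj 0 u → ∃ v : Fin n, (G.Adj 0 v ∧ G.Adj u v) ∧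
      ∃ k < L, (neighbours G u)[k]? = some v := by
    intro u hu _
    obtain ⟨v, hv, hrelay⟩ := hG u hu
    obtain ⟨k, hk, hkv⟩ := exists_getElem?_neighbours hrelay.2
    exact ⟨v, hrelay, k, hk.trans_lt (mem_filter.1 hv).2, hkv⟩
  choose! up up_relay up_entry using hup
  obtain ⟨table, table_length, table_stored⟩ := hj up_relay down_relay down_entry
  have hnode : ∀ u, u ≠ 0 → ∃ p : List Bool,
      p.length = i + (if G.Adj 0 u then 0 else Nat.clog 2 L) ∧
        (hubScheme up_relay down_relay).StoredBy u p := by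
    intro u hu
    split_ifs with h
    · obtain ⟨k, hk, hk0⟩ := exists_getElem?_neighbours h.symm
      exact hi _ _ hu (Nat.lt_succ_of_le hk) (by rwa [if_pos h])
    · obtain ⟨k, hk, hku⟩ := up_entry u hu h
      exact hi _ _ hu (hk.trans_le (Nat.le_pow_clog one_lt_two L)) (by rwa [if_neg h])
  choose! node node_length node_stored using hnode
  refine ⟨hubScheme up_relay down_relay, Function.update node 0 table,
    hubScheme_stretchAtMost_two _ _, fun v => ?_, ?_, fun v hv => ?_⟩
  · rcases eq_or_ne v 0 with rfl | hv
    · rwa [Function.update_self]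
    · simpa only [Function.update_of_ne hv] using node_stored v hv
  · rw [Function.update_self, table_length]
  · rw [Function.update_of_ne hv, node_length v hv]

end Storage

section Total

variable {n : ℕ} [NeZero n] {G : SimpleGraph (Fin n)} {store : Fin n → List Bool} {i k : ℕ}

open Classical in
theorem sum_length_le_of_length_eq
    (hnode : ∀ v, v ≠ 0 → (store v).length = i + if G.Adj 0 v then 0 else k) :
    ∑ v, (store v).length ≤ (store 0).length + n * i + Gᶜ.degree 0 * k := by
  have hdegree : ∑ v ∈ univ.erase 0, (if G.Adj 0 v then 0 else k) = Gᶜ.degree 0 * k := by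
    rw [sum_ite, sum_const_zero, zero_add, sum_const, smul_eq_mul,
      ← SimpleGraph.card_neighborFinset_eq_degree]
    congr 2
    ext v
    simp only [mem_filter, mem_erase, mem_univ, and_true, SimpleGraph.mem_neighborFinset,
      SimpleGraph.compl_adj, ne_comm]
  rw [← add_sum_erase univ _ (mem_univ 0), sum_congr rfl fun v hv => hnode v (ne_of_mem_erase hv),
    sum_add_distrib, hdegree, sum_const, card_erase_of_mem (mem_univ 0), card_univ,
    Fintype.card_fin, smul_eq_mul, add_assoc]
  gcongr
  exact Nat.sub_le n 1

open Classical in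
/-- Only the nodes that are not adjacent to the hub, fewer than three quarters of all nodes, pay
`k ≈ ℓ` bits: the remaining `n * ℓ / 4` bits absorb the constants. -/
theorem sum_length_le_mul_add {ℓ C : ℝ}
    (hnode : ∀ v, v ≠ 0 → (store v).length = i + if G.Adj 0 v then 0 else k)
    (hroot : (store 0).length ≤ 3 * n) (hdegree : 4 * Gᶜ.degree 0 < 3 * n) (hk : (k : ℝ) ≤ ℓ + C)
    (hℓ : 4 * i + 3 * C ≤ ℓ) : ((∑ v, (store v).length : ℕ) : ℝ) ≤ n * ℓ + 3 * n := by
  have hdegree' : (Gᶜ.degree 0 : ℝ) ≤ 3 / 4 * n := by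
    have : (4 * Gᶜ.degree 0 : ℝ) ≤ 3 * n := by exact_mod_cast hdegree.le
    linarith
  calc ((∑ v, (store v).length : ℕ) : ℝ) ≤ (3 * n + n * i + Gᶜ.degree 0 * k : ℕ) := by
        exact_mod_cast (sum_length_le_of_length_eq hnode).trans (by gcongr)
    _ = 3 * n + n * i + Gᶜ.degree 0 * k := by push_cast; rfl
    _ ≤ 3 * n + n * i + 3 / 4 * n * (ℓ + C) := by gcongr
    _ = n * (4 * i + 3 * C) / 4 + 3 / 4 * (n * ℓ) + 3 * n := by ring
    _ ≤ n * ℓ / 4 + 3 / 4 * (n * ℓ) + 3 * n := by gcongr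
    _ = n * ℓ + 3 * n := by ring

end Total

section Asymptotics

theorem two_rpow_mul_logb_le (c : ℝ) {n : ℕ} (hn : n ≠ 0) :
    (2 : ℝ) ^ (c * Real.logb 2 n) ≤ (n : ℝ) ^ ⌈c⌉₊ := by
  have hn1 : (1 : ℝ) ≤ n := by exact_mod_cast Nat.one_le_iff_ne_zero.2 hn
  calc (2 : ℝ) ^ (c * Real.logb 2 n) = (n : ℝ) ^ c := by
        rw [mul_comm, Real.rpow_mul two_pos.le,
          Real.rpow_logb two_pos (by norm_num) (by positivity)]
    _ ≤ (n : ℝ) ^ (⌈c⌉₊ : ℝ) := Real.rpow_le_rpow_of_exponent_le hn1 (Nat.le_ceil c)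
    _ = (n : ℝ) ^ ⌈c⌉₊ := Real.rpow_natCast _ _

theorem tendsto_two_rpow_mul_logb_mul_zero {c : ℝ} {q : ℕ → ℝ} (hq : ∀ n, 0 ≤ q n)
    (h : Tendsto (fun n : ℕ => (n : ℝ) ^ ⌈c⌉₊ * q n) atTop (𝓝 0)) :
    Tendsto (fun n : ℕ => (2 : ℝ) ^ (c * Real.logb 2 n) * q n) atTop (𝓝 0) := by
  refine squeeze_zero' (Eventually.of_forall fun n => mul_nonneg (by positivity) (hq n)) ?_ h
  filter_upwards [eventually_ne_atTop 0] with n hn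
  exact mul_le_mul_of_nonneg_right (two_rpow_mul_logb_le c hn) (hq n)

/-- The number of nodes, of order `log n`, among which a `c log n`-random graph has a common
neighbour of `0` and any other node, if `m` is large compared to `c`. -/
def linkBound (m n : ℕ) : ℕ := m * (Nat.log 2 n + 1) + 2

theorem primrec_linkBound (m : ℕ) : Primrec (linkBound m) :=
  Primrec.nat_add.comp (Primrec.nat_mul.comp (Primrec.const m)
    (Primrec.succ.comp (primrec_nat_log one_lt_two))) (Primrec.const 2)

theorem linkBound_le_mul_logb (m : ℕ) {n : ℕ} (hn : 2 ≤ n) :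
    (linkBound m n : ℝ) ≤ (2 * m + 2) * Real.logb 2 n := by
  have hlog : (Nat.log 2 n : ℝ) ≤ Real.logb 2 n := by
    rw [← Real.natFloor_logb_natCast]
    exact Nat.floor_le (Real.logb_nonneg one_lt_two (by exact_mod_cast one_le_two.trans hn))
  have hone : 1 ≤ Real.logb 2 n := by
    rw [Real.le_logb_iff_rpow_le one_lt_two (by positivity), Real.rpow_one]
    exact_mod_cast hn
  calc (linkBound m n : ℝ) = m * (Nat.log 2 n + 1) + 2 * 1 := by simp [linkBound]
    _ ≤ m * (Real.logb 2 n + Real.logb 2 n) + 2 * Real.logb 2 n := by gcongr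
    _ = (2 * m + 2) * Real.logb 2 n := by ring

theorem eventually_linkBound_le (m : ℕ) : ∀ᶠ n in atTop, linkBound m n ≤ n := by
  have hlittleO := (Real.isLittleO_log_id_atTop.comp_tendsto
    tendsto_natCast_atTop_atTop).const_mul_left ((2 * m + 2) / Real.log 2)
  filter_upwards [hlittleO.def one_pos, eventually_ge_atTop 2] with n hlog hn
  have hle : (linkBound m n : ℝ) ≤ n := by
    calc (linkBound m n : ℝ) ≤ (2 * m + 2) * Real.logb 2 n := linkBound_le_mul_logb m hn
      _ = (2 * m + 2) / Real.log 2 * Real.log n := by rw [Real.logb]; ring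
      _ ≤ n := (le_abs_self _).trans (by
          simpa only [Function.comp_apply, id, one_mul, Real.norm_eq_abs, Nat.abs_cast] using hlog)
  exact_mod_cast hle

theorem exists_clog_linkBound_le (m : ℕ) : ∃ C : ℝ, ∀ n : ℕ, 2 ≤ n →
    (Nat.clog 2 (linkBound m n) : ℝ) ≤ Real.logb 2 (Real.logb 2 n) + C := by
  refine ⟨Real.logb 2 (2 * m + 2) + 1, fun n hn => ?_⟩
  have hone : (1 : ℝ) ≤ linkBound m n := by
    exact_mod_cast Nat.succ_le_of_lt (Nat.succ_pos _)
  have hlogb : 0 < Real.logb 2 n :=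
    Real.logb_pos one_lt_two (by exact_mod_cast one_lt_two.trans_le hn)
  calc (Nat.clog 2 (linkBound m n) : ℝ) ≤ Real.logb 2 (linkBound m n) + 1 := by
        rw [← Real.natCeil_logb_natCast]
        exact (Nat.ceil_lt_add_one (Real.logb_nonneg one_lt_two hone)).le
    _ ≤ Real.logb 2 ((2 * m + 2) * Real.logb 2 n) + 1 := by
        gcongr
        · norm_num
        · exact linkBound_le_mul_logb m hn
    _ = Real.logb 2 (Real.logb 2 n) + (Real.logb 2 (2 * m + 2) + 1) := by
        rw [Real.logb_mul (by positivity) hlogb.ne']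
        ring

theorem eventually_le_logb_logb (a : ℝ) :
    ∀ᶠ n : ℕ in atTop, a ≤ Real.logb 2 (Real.logb 2 n) :=
  ((Real.tendsto_logb_atTop one_lt_two).comp ((Real.tendsto_logb_atTop one_lt_two).comp
    tendsto_natCast_atTop_atTop)).eventually_ge_atTop a

theorem mul_three_quarters_pow_le (k : ℕ) {n : ℕ} (hn : n ≠ 0) :
    (n : ℝ) * (3 / 4) ^ (linkBound (3 * (k + 1)) n - 2) ≤ ((n : ℝ) ^ k)⁻¹ := by
  have hlt : (n : ℝ) ≤ 2 ^ (Nat.log 2 n + 1) := by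
    exact_mod_cast (Nat.lt_pow_succ_log_self one_lt_two n).le
  calc (n : ℝ) * (3 / 4) ^ (linkBound (3 * (k + 1)) n - 2)
      = n * ((27 / 64) ^ (Nat.log 2 n + 1)) ^ (k + 1) := by
        rw [linkBound, Nat.add_sub_cancel, mul_assoc, mul_comm (k + 1), pow_mul, pow_mul]
        norm_num
    _ ≤ n * ((1 / 2) ^ (Nat.log 2 n + 1)) ^ (k + 1) := by
        gcongr n * (?_ ^ _) ^ _
        norm_num
    _ ≤ n * ((n : ℝ)⁻¹) ^ (k + 1) := by
        rw [one_div, inv_pow]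
        gcongr
    _ = ((n : ℝ) ^ k)⁻¹ := by
        rw [pow_succ', mul_inv_cancel_left₀ (by exact_mod_cast hn), inv_pow]

end Asymptotics

section RandomGraphProperties

variable (c : ℝ)

open Classical in
theorem eventually_degree_compl_lt :
    ∀ᶠ n : ℕ in atTop, ∀ [NeZero n] (G : SimpleGraph (Fin n)),
      IsRandomGraph (fun m : ℕ => c * Real.logb 2 m) G → 4 * Gᶜ.degree 0 < 3 * n := by
  have hprob : ∀ᶠ n in atTop, ∀ [NeZero n], randomGraphProb
      (fun G : SimpleGraph (Fin n) => 3 * n ≤ 4 * Gᶜ.degree 0) ≤ (97 / 108) ^ n :=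
    Eventually.of_forall fun n _ => by
      simpa only [Fintype.card_fin] using randomGraphProb_degree_compl_le (0 : Fin n)
  have hlim : Tendsto (fun n : ℕ => (n : ℝ) ^ ⌈c⌉₊ * (97 / 108) ^ n) atTop (𝓝 0) :=
    tendsto_pow_const_mul_const_pow_of_lt_one _ (by norm_num) (by norm_num)
  refine (isPrimrecProperty_degree_compl.eventually_not hprob
    (tendsto_two_rpow_mul_logb_mul_zero (fun n => by positivity) hlim)).mono ?_
  exact fun n h _ G hG => not_le.1 (h G hG)

theorem eventually_tableLength_le (K : ℕ) :
    ∀ᶠ n : ℕ in atTop, ∀ [NeZero n] (G : SimpleGraph (Fin n)),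
      IsRandomGraph (fun m : ℕ => c * Real.logb 2 m) G → tableLength G 0 + K ≤ 3 * n := by
  have hprob : ∀ᶠ n in atTop, ∀ [NeZero n], randomGraphProb
      (fun G : SimpleGraph (Fin n) => 3 * n < tableLength G 0 + K) ≤ (4 / 3) ^ K * (27 / 32) ^ n :=
    Eventually.of_forall fun n _ => randomGraphProb_tableLength_le K 0
  have hlim : Tendsto (fun n : ℕ => (n : ℝ) ^ ⌈c⌉₊ * ((4 / 3) ^ K * (27 / 32) ^ n)) atTop
      (𝓝 0) := by
    simpa only [mul_zero, mul_left_comm] using (tendsto_pow_const_mul_const_pow_of_lt_one ⌈c⌉₊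
      (by norm_num : (0 : ℝ) ≤ 27 / 32) (by norm_num)).const_mul ((4 / 3) ^ K)
  refine ((isPrimrecProperty_tableLength K).eventually_not hprob
    (tendsto_two_rpow_mul_logb_mul_zero (fun n => by positivity) hlim)).mono ?_
  exact fun n h _ G hG => not_lt.1 (h G hG)

theorem exists_eventually_linkedThrough :
    ∃ m, ∀ᶠ n : ℕ in atTop, ∀ [NeZero n] (G : SimpleGraph (Fin n)),
      IsRandomGraph (fun k : ℕ => c * Real.logb 2 k) G →
        LinkedThrough G 0 {v | (v : ℕ) < linkBound m n} := by
  set k := ⌈c⌉₊ + 1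
  refine ⟨3 * (k + 1), ?_⟩
  have hprob : ∀ᶠ n in atTop, ∀ [NeZero n], randomGraphProb (fun G : SimpleGraph (Fin n) =>
      ¬ LinkedThrough G 0 {v | (v : ℕ) < linkBound (3 * (k + 1)) n}) ≤ ((n : ℝ) ^ k)⁻¹ := by
    filter_upwards [eventually_linkBound_le (3 * (k + 1))] with n hn _
    refine (randomGraphProb_not_linkedThrough_le _ _).trans ?_
    rw [Fin.card_filter_val_lt, min_eq_right hn, Fintype.card_fin]
    exact mul_three_quarters_pow_le k (NeZero.ne n)
  have hlim : Tendsto (fun n : ℕ => (n : ℝ) ^ ⌈c⌉₊ * ((n : ℝ) ^ k)⁻¹) atTop (𝓝 0) := by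
    refine (tendsto_inv_atTop_nhds_zero_nat (𝕜 := ℝ)).congr' ?_
    filter_upwards [eventually_ne_atTop 0] with n hn
    rw [pow_succ, mul_inv, mul_inv_cancel_left₀ (by positivity)]
  refine ((isPrimrecProperty_not_linkedThrough (primrec_linkBound (3 * (k + 1)))).eventually_not
    hprob (tendsto_two_rpow_mul_logb_mul_zero (fun n => by positivity) hlim)).mono ?_
  exact fun n h _ G hG => not_not.1 (h G hG)

end RandomGraphProperties

end CompactRouting

theorem mainTheorem11 (c : ℝ) (hc : 0 ≤ c) :
    ∃ (C : ℝ) (N : ℕ), ∀ n : ℕ, N ≤ n → ∀ G : SimpleGraph (Fin n),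
      CompactRouting.IsRandomGraph (fun m : ℕ => c * Real.logb 2 (m : ℝ)) G →
      ∃ (F : CompactRouting.RoutingScheme G) (store : Fin n → List Bool) (r : Fin n),
        F.StretchAtMost 2 ∧
        (∀ v, F.StoredBy v (store v)) ∧
        (∀ v, v ≠ r →
          ((store v).length : ℝ) ≤ Real.logb 2 (Real.logb 2 (n : ℝ)) + C) ∧
        (store r).length ≤ 3 * n ∧
        ((∑ v, (store v).length : ℕ) : ℝ) ≤
          (n : ℝ) * Real.logb 2 (Real.logb 2 (n : ℝ)) + 3 * (n : ℝ) := by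
  classical
  obtain ⟨i, j, hscheme⟩ := CompactRouting.exists_routingScheme_storedBy
  obtain ⟨m, hlinked⟩ := CompactRouting.exists_eventually_linkedThrough c
  obtain ⟨C, hclog⟩ := CompactRouting.exists_clog_linkBound_le m
  refine ⟨i + C, Filter.eventually_atTop.1 ?_⟩
  filter_upwards [CompactRouting.eventually_degree_compl_lt c,
    CompactRouting.eventually_tableLength_le c j, hlinked,
    CompactRouting.eventually_le_logb_logb (4 * i + 3 * C), Filter.eventually_ge_atTop 2]
    with n hdegree htable hlinked hloglog hn G hG
  have : NeZero n := ⟨by lia⟩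
  obtain ⟨F, store, hstretch, hstored, hroot, hnode⟩ := hscheme n _ G (hlinked G hG)
  have hroot_le : (store 0).length ≤ 3 * n := by
    rw [hroot, add_comm]
    exact htable G hG
  refine ⟨F, store, 0, hstretch, hstored, fun v hv => ?_, hroot_le,
    CompactRouting.sum_length_le_mul_add hnode hroot_le (hdegree G hG) (hclog n hn) hloglog⟩
  have hlength : (store v).length ≤ i + Nat.clog 2 (CompactRouting.linkBound m n) := by
    rw [hnode v hv]
    split_ifs <;> lia
  calc ((store v).length : ℝ) ≤ i + Nat.clog 2 (CompactRouting.linkBound m n) := by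
        exact_mod_cast hlength
    _ ≤ Real.logb 2 (Real.logb 2 n) + (i + C) := by linarith [hclog n hn]
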